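/- **Conventions.** All Hilbert spaces are complex. A *kernel* on a set $X$ is a function $k:X\times X\to\mathbb C$ such that $[k(x_i,x_j)]_{i,j}$ is positive semi-definite for every finite subset $\{x_1,\dots,x_n\}\subset X$; we then write $k\ge 0$. For a kernel $k$, let $\mathcal H_k$ be its reproducing kernel Hilbert space. For a Hilbert space $\mathcal E$, regard $\mathcal H_k\otimes\mathcal E$ as the space of $\mathcal E$-valued functions on $X$ that is the reproducing kernel Hilbert space of the operator-valued kernel $k(x,y)I_{\mathcal E}$. For kernels $\ell,k$ and Hilbert spaces $\mathcal F,\mathcal E$, $\operatorname{Mult}(\mathcal H_\ell\otimes\mathcal F,\mathcal H_k\otimes\mathcal E)$ is the set of all functions $\Phi:X\to\mathcal B(\mathcal F,\mathcal E)$ such that $\Phi\cdot f:x\mapsto\Phi(x)f(x)$ belongs to $\mathcal H_k\otimes\mathcal E$ for every $f\in\mathcal H_\ell\otimes\mathcal F$; we write $M_\Phi f=\Phi\cdot f$ and $\Phi\cdot(\mathcal H_\ell\otimes\mathcal F)$ for the range of $M_\Phi$. The operator $M_\Phi$ is automatically bounded, and $\Phi$ is called a *contractive* (respectively *partially isometric*)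 multiplier if $M_\Phi$ is a contraction (respectively a partial isometry). $\operatorname{Mult}(\mathcal H_s)$ is the set of functions $\varphi:X\to\mathbb C$ with $\varphi\mathcal H_s\subset\mathcal H_s$, and a subspace $\mathcal M\subset\mathcal H_k\otimes\mathcal E$ is *$\operatorname{Mult}(\mathcal H_s)$-invariant* if $\varphi f\in\mathcal M$ for all $\varphi\in\operatorname{Mult}(\mathcal H_s)$ and $f\in\mathcal M$. A kernel $s$ is *normalized* if there is $x_0\in X$ with $s(x,x_0)=1$ for all $x\in X$. It is a *complete Nevanlinna–Pick kernel* if for all $m,n\in\mathbb N$, every finite subset $\{x_1,\dots,x_N\}\subset X$ and all complex $m\times n$ matrices $W_1,\dots,W_N$ such that the block matrix $[s(x_i,x_j)(I_m-W_iW_j^*)]_{i,j}$ is positive semi-definite, there is a contractive multiplier $\Phi\in\operatorname{Mult}(\mathcal H_s\otimes\mathbb C^n,\mathcal H_s\otimes\mathbb C^m)$ with $\Phi(x_i)=W_i$ for all $i$. (A normalized complete Nevanlinna–Pick kernel vanishes nowhere, so $k/s$ below is defined.) **Theorem 1.4.** Let $X$ be a set, let $k$ be a kernel on $X$ and let $s$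 be a normalized complete Nevanlinna–Pick kernel on $X$ such that $k/s\ge 0$. Let $\mathcal E,\mathcal F$ be Hilbert spaces and let $\mathcal N\subset\mathcal M\subset\mathcal H_k\otimes\mathcal E$ be two non-zero closed subspaces. Let $\Phi\in\operatorname{Mult}(\mathcal H_s\otimes\mathcal F,\mathcal H_k\otimes\mathcal E)$ be a partially isometric multiplier with $\mathcal M=\Phi\cdot(\mathcal H_s\otimes\mathcal F)$, and suppose that $\mathcal N$ is $\operatorname{Mult}(\mathcal H_s)$-invariant. Then there exist a Hilbert space $\mathcal G$ and a partially isometric multiplier $\Gamma\in\operatorname{Mult}(\mathcal H_s\otimes\mathcal G,\mathcal H_s\otimes\mathcal F)$ such that $\Phi\Gamma:x\mapsto\Phi(x)\Gamma(x)$ is a partially isometric multiplier in $\operatorname{Mult}(\mathcal H_s\otimes\mathcal G,\mathcal H_k\otimes\mathcal E)$ and $\mathcal N=(\Phi\Gamma)\cdot(\mathcal H_s\otimes\mathcal G)$. -/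

import Mathlib

universe u v w

section Definitions

open scoped ComplexOrder InnerProductSpace ComplexConjugate

/-- A (positive semi-definite) kernel on `X`: a function `X × X → ℂ` all of whose finite sections
`[k (x i) (x j)]` are positive semi-definite complex matrices. -/
structure PDKernel (X : Type u) where
  /-- The underlying function of two variables. -/
  toFun : X → X → ℂ
  posSemidef : (Matrix.of toFun).PosSemidef

namespace PDKernel

variable {X : Type u}

instance : CoeFun (PDKernel X) (fun _ => X → X → ℂ) := ⟨PDKernel.toFun⟩

/-- The operator-valued kernel `k(x, y) I_E`. -/
noncomputable def opKernel (k : PDKernel X) (E : Type v) [NormedAddCommGroup E]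
    [InnerProductSpace ℂ E] : Matrix X X (E →L[ℂ] E) :=
  Matrix.of fun x y => k x y • ContinuousLinearMap.id ℂ E

theorem posSemidef_opKernel (k : PDKernel X) (E : Type v) [NormedAddCommGroup E]
    [InnerProductSpace ℂ E] [CompleteSpace E] : (k.opKernel E).PosSemidef := by
  have hH : (k.opKernel E).IsHermitian := by
    ext x y v
    have h := k.posSemidef.isHermitian.apply x y
    simp only [Matrix.of_apply] at h
    have hid : ContinuousLinearMap.adjoint (ContinuousLinearMap.id ℂ E) =
        ContinuousLinearMap.id ℂ E := ContinuousLinearMap.adjoint_id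
    simp [opKernel, Matrix.conjTranspose_apply, ContinuousLinearMap.star_eq_adjoint, ← h, hid]
  refine (RKHS.posSemidef_tfae.out 0 2).mpr (And.intro hH fun f => ?_)
  have hG : (Matrix.gram ℂ (fun x : f.support => f x)).PosSemidef := Matrix.posSemidef_gram ℂ _
  have h := ((k.posSemidef.submatrix (fun i : f.support => (i : X))).hadamard
    hG).dotProduct_mulVec_nonneg (fun _ => 1)
  have h' := (Complex.nonneg_iff.mp h).1
  convert h' using 1
  simp only [dotProduct, Matrix.mulVec, Matrix.hadamard_apply, Matrix.submatrix_apply,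
    Matrix.of_apply, Matrix.gram_apply, Finsupp.sum, Pi.star_apply, star_one, one_mul, mul_one]
  rw [← Finset.sum_coe_sort]
  refine congrArg Complex.re (Finset.sum_congr rfl fun x _ => ?_)
  rw [← Finset.sum_coe_sort]
  refine Finset.sum_congr rfl fun y _ => ?_
  have hk := k.posSemidef.isHermitian.apply (x : X) (y : X)
  simp only [Matrix.of_apply] at hk
  simp [opKernel, inner_smul_left, ← hk]

instance (k : PDKernel X) (E : Type v) [NormedAddCommGroup E]
    [InnerProductSpace ℂ E] [CompleteSpace E] : Fact (k.opKernel E).PosSemidef :=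
  ⟨k.posSemidef_opKernel E⟩

/-- `H_k ⊗ E`: the reproducing kernel Hilbert space of `E`-valued functions on `X` with
operator-valued kernel `k(x, y) I_E`. The scalar space `H_k` is `k.Space ℂ`. -/
def Space (k : PDKernel X) (E : Type v) [NormedAddCommGroup E]
    [InnerProductSpace ℂ E] [CompleteSpace E] : Type (max u v) :=
  RKHS.OfKernel (k.opKernel E)

section

variable (k : PDKernel X) (E : Type v) [NormedAddCommGroup E]
    [InnerProductSpace ℂ E] [CompleteSpace E]

noncomputable instance : NormedAddCommGroup (k.Space E) :=
  inferInstanceAs (NormedAddCommGroup (RKHS.OfKernel (k.opKernel E)))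

noncomputable instance : InnerProductSpace ℂ (k.Space E) :=
  inferInstanceAs (InnerProductSpace ℂ (RKHS.OfKernel (k.opKernel E)))

instance : CompleteSpace (k.Space E) :=
  inferInstanceAs (CompleteSpace (RKHS.OfKernel (k.opKernel E)))

/-- Elements of `H_k ⊗ E` are functions `X → E`: for `f : k.Space E`, `f x` is the value at `x`. -/
noncomputable instance : RKHS ℂ (k.Space E) X E :=
  inferInstanceAs (RKHS ℂ (RKHS.OfKernel (k.opKernel E)) X E)

theorem kernel_space (x y : X) :
    RKHS.kernel (k.Space E) x y = k x y • ContinuousLinearMap.id ℂ E :=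
  congrFun (congrFun (RKHS.OfKernel.kernel_ofKernel (K := k.opKernel E)) x) y

end

/-- The pointwise quotient `k / s` is positive semi-definite. -/
def QuotientNonneg (k s : PDKernel X) : Prop :=
  (Matrix.of fun x y => k x y / s x y).PosSemidef

/-- `k` is normalized: `k(x, x₀) = 1` for all `x`, for some point `x₀`. -/
def IsNormalized (k : PDKernel X) : Prop := ∃ x₀, ∀ x, k x x₀ = 1

section Multipliers

variable {E : Type v} [NormedAddCommGroup E] [InnerProductSpace ℂ E] [CompleteSpace E]
  {F : Type w} [NormedAddCommGroup F] [InnerProductSpace ℂ F] [CompleteSpace F]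

/-- `Φ ∈ Mult(H_l ⊗ F, H_k ⊗ E)`: pointwise application of the `B(F, E)`-valued function `Φ`
maps `H_l ⊗ F` into `H_k ⊗ E`. -/
def IsMultiplier (l k : PDKernel X) (Φ : X → F →L[ℂ] E) : Prop :=
  ∀ f : l.Space F, ∃ g : k.Space E, ∀ x, g x = Φ x (f x)

variable {l k : PDKernel X} {Φ : X → F →L[ℂ] E}

/-- The multiplication operator as a linear map. -/
noncomputable def mulLinear (hΦ : IsMultiplier l k Φ) : l.Space F →ₗ[ℂ] k.Space E where
  toFun f := (hΦ f).choose
  map_add' f g := RKHS.ext fun x => by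
    rw [(hΦ (f + g)).choose_spec x]
    simp [(hΦ f).choose_spec, (hΦ g).choose_spec]
  map_smul' c f := RKHS.ext fun x => by
    rw [(hΦ (c • f)).choose_spec x]
    simp [(hΦ f).choose_spec]

theorem mulLinear_apply (hΦ : IsMultiplier l k Φ) (f : l.Space F) (x : X) :
    mulLinear hΦ f x = Φ x (f x) := (hΦ f).choose_spec x

/-- The multiplication operator `M_Φ : H_l ⊗ F → H_k ⊗ E`, which is bounded by the closed graph
theorem. -/
noncomputable def mulOp (hΦ : IsMultiplier l k Φ) : l.Space F →L[ℂ] k.Space E :=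
  ContinuousLinearMap.ofSeqClosedGraph (g := mulLinear hΦ) fun u f g hu hg => RKHS.ext fun x => by
    have h1 := ((RKHS.continuous_eval (H := k.Space E) x).tendsto g).comp hg
    have h2 := (((Φ x).continuous.comp (RKHS.continuous_eval (H := l.Space F) x)).tendsto f).comp hu
    rw [mulLinear_apply]
    refine tendsto_nhds_unique h1 (h2.congr fun n => ?_)
    simp [mulLinear_apply]

theorem mulOp_apply (hΦ : IsMultiplier l k Φ) (f : l.Space F) (x : X) :
    mulOp hΦ f x = Φ x (f x) := mulLinear_apply hΦ f x

/-- `Φ` is a contractive multiplier from `H_l ⊗ F` to `H_k ⊗ E`. -/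
def IsContractiveMultiplier (l k : PDKernel X) (Φ : X → F →L[ℂ] E) : Prop :=
  ∃ hΦ : IsMultiplier l k Φ, ‖mulOp hΦ‖ ≤ 1

/-- A bounded operator between Hilbert spaces is a partial isometry if it is isometric on the
orthogonal complement of its kernel. -/
def IsPartialIsometry {H : Type*} {K : Type*} [NormedAddCommGroup H] [InnerProductSpace ℂ H]
    [NormedAddCommGroup K] [InnerProductSpace ℂ K] (T : H →L[ℂ] K) : Prop :=
  ∀ f ∈ T.kerᗮ, ‖T f‖ = ‖f‖

/-- `Φ` is a partially isometric multiplier from `H_l ⊗ F` to `H_k ⊗ E`. -/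
def IsPartiallyIsometricMultiplier (l k : PDKernel X) (Φ : X → F →L[ℂ] E) : Prop :=
  ∃ hΦ : IsMultiplier l k Φ, IsPartialIsometry (mulOp hΦ)

/-- The set `Φ · (H_l ⊗ F)`, as a subset of `H_k ⊗ E`. -/
def mulRange (l k : PDKernel X) (Φ : X → F →L[ℂ] E) : Set (k.Space E) :=
  {g | ∃ f : l.Space F, ∀ x, g x = Φ x (f x)}

/-- A scalar function `φ` belongs to `Mult(H_s)`. -/
def MemMult (s : PDKernel X) (φ : X → ℂ) : Prop :=
  ∀ f : s.Space ℂ, ∃ g : s.Space ℂ, ∀ x, g x = φ x * f x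

/-- The subspace `M` of `H_k ⊗ E` is `Mult(H_s)`-invariant: `φ M ⊆ M` for all `φ ∈ Mult(H_s)`. -/
def IsMultInvariant (s : PDKernel X) (M : Submodule ℂ (k.Space E)) : Prop :=
  ∀ φ : X → ℂ, MemMult s φ → ∀ f ∈ M, ∃ g ∈ M, ∀ x, g x = φ x • f x

/-- `s` is a complete Nevanlinna-Pick kernel: for all matrix sizes `m × n`, every finite set of
points and every assignment `W` of `m × n` matrices to these points for which the Pick matrix
`[s(x, y) (I - W(x) W(y)^*)]` is positive semi-definite, there is a contractive multiplier from
`H_s ⊗ ℂ^n` to `H_s ⊗ ℂ^m` that interpolates `W`. -/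
def IsCompleteNP (s : PDKernel X) : Prop :=
  ∀ (m n : ℕ) (S : Finset X)
    (W : S → EuclideanSpace ℂ (Fin n) →L[ℂ] EuclideanSpace ℂ (Fin m)),
    (Matrix.of fun x y : S => s x y •
      (ContinuousLinearMap.id ℂ (EuclideanSpace ℂ (Fin m)) -
        W x ∘L ContinuousLinearMap.adjoint (W y))).PosSemidef →
    ∃ Φ : X → EuclideanSpace ℂ (Fin n) →L[ℂ] EuclideanSpace ℂ (Fin m),
      IsContractiveMultiplier s s Φ ∧ ∀ x : S, Φ x = W x

end Multipliers

end PDKernel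
end Definitions

/-!
Let `L` be the preimage of `N` under `M_Φ`. It is a closed multiplier invariant subspace of
`H_s ⊗ F` that contains `ker M_Φ`. If `M_Γ M_Γ* = P_L`, then `M_Γ` is a partial isometry with range
`L`, and since `P_L` commutes with the initial projection of the partial isometry `M_Φ`,
`M_{ΦΓ} M_{ΦΓ}* = M_Φ P_L M_Φ*` is the projection onto `N`
(`IsPartialIsometry.map_starProjection_comap`). So only the Beurling-Lax-Halmos theorem inside
`H_s ⊗ F` is needed (`IsCompleteNP.exists_mulOp_comp_adjoint_eq`), and no lifting theorem for
multipliers.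

To obtain `Γ`, write `K_L` for the reproducing kernel of `L`. If `K_L / s` is positive
semi-definite, it factors as `Γ(x) Γ(y)*` through its own reproducing kernel Hilbert space `G`, and
`K_L(x, y) = s(x, y) Γ(x) Γ(y)*` says that `M_Γ M_Γ* = P_L`. Positivity only involves finitely many
points at a time. On a finite set, `1 - 1/s` is the Gram matrix of a tuple of rows, the Pick matrix
of these rows is the constant matrix `1`, and the Nevanlinna-Pick property interpolates them by a
contractive row multiplier. This row maps tuples in `L` contractively into `L`, which is the
positivity of `(1 - (1 - 1/s)) K_L` (`IsCompleteNP.re_sum_nonneg`).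

The positivity of `1 - 1/s` is the McCullough-Quiggin theorem (`IsCompleteNP.posSemidef_one_sub`).
It comes from the same principle, applied to the invariant subspaces of functions in `H_s` that
vanish at a point, by induction on the number of points with a varying base point.
-/

open scoped ComplexOrder InnerProductSpace ComplexConjugate

namespace PDKernel

/-! ### Partial isometries and Gram matrices -/

section Hilbert

variable {H K : Type*} [NormedAddCommGroup H] [InnerProductSpace ℂ H] [CompleteSpace H]
  [NormedAddCommGroup K] [InnerProductSpace ℂ K] [CompleteSpace K]

theorem range_eq_of_comp_adjoint_eq (T : H →L[ℂ] K) (L : Submodule ℂ K)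
    [L.HasOrthogonalProjection]
    (hT : ∀ g, T (ContinuousLinearMap.adjoint T g) = L.starProjection g) :
    Set.range T = L := by
  refine Set.Subset.antisymm ?_ fun g hg => ⟨ContinuousLinearMap.adjoint T g, ?_⟩
  · rintro _ ⟨f, rfl⟩
    rw [SetLike.mem_coe, ← L.orthogonal_orthogonal]
    refine (Submodule.mem_orthogonal _ _).mpr fun g hg => ?_
    have h0 : ContinuousLinearMap.adjoint T g = 0 := by
      rw [← inner_self_eq_zero (𝕜 := ℂ), ContinuousLinearMap.adjoint_inner_left, hT,
        L.starProjection_apply_eq_zero_iff.mpr hg, inner_zero_right]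
    rw [← ContinuousLinearMap.adjoint_inner_left, h0, inner_zero_left]
  · rw [hT, Submodule.starProjection_eq_self_iff.mpr hg]

theorem isPartialIsometry_of_comp_adjoint_eq (T : H →L[ℂ] K) (L : Submodule ℂ K)
    [L.HasOrthogonalProjection]
    (hT : ∀ g, T (ContinuousLinearMap.adjoint T g) = L.starProjection g) :
    IsPartialIsometry T := by
  intro f hf
  have hrange : T f ∈ L := by
    rw [← SetLike.mem_coe, ← range_eq_of_comp_adjoint_eq T L hT]
    exact Set.mem_range_self f
  have hker : ContinuousLinearMap.adjoint T (T f) - f ∈ T.ker := by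
    rw [LinearMap.mem_ker]
    change T _ = 0
    rw [map_sub, hT, Submodule.starProjection_eq_self_iff.mpr hrange, sub_self]
  have hperp : ContinuousLinearMap.adjoint T (T f) - f ∈ T.kerᗮ := by
    refine Submodule.sub_mem _ ((Submodule.mem_orthogonal _ _).mpr fun g hg => ?_) hf
    rw [ContinuousLinearMap.adjoint_inner_right]
    have : T g = 0 := hg
    rw [this, inner_zero_left]
  have hfix : ContinuousLinearMap.adjoint T (T f) = f := by
    rw [← sub_eq_zero, ← inner_self_eq_zero (𝕜 := ℂ)]
    exact (Submodule.mem_orthogonal _ _).mp hperp _ hker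
  have h := ContinuousLinearMap.apply_norm_sq_eq_inner_adjoint_right T f
  rw [show (ContinuousLinearMap.adjoint T ∘L T) f = f from hfix, inner_self_eq_norm_sq] at h
  exact (sq_eq_sq₀ (norm_nonneg _) (norm_nonneg _)).mp h

omit [CompleteSpace K] in
/-- Every value of `T` is taken on the initial space `(ker T)ᗮ`. -/
theorem map_starProjection_ker_orthogonal (T : H →L[ℂ] K) (g : H) :
    T (T.kerᗮ.starProjection g) = T g := by
  rw [eq_comm, ← sub_eq_zero, ← map_sub]
  have h := Submodule.sub_starProjection_mem_orthogonal (K := T.kerᗮ) g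
  rwa [Submodule.orthogonal_orthogonal_eq_closure, IsClosed.submodule_topologicalClosure_eq
    (ContinuousLinearMap.isClosed_ker T)] at h

omit [CompleteSpace K] in
theorem IsPartialIsometry.inner_map_map {T : H →L[ℂ] K} (hT : IsPartialIsometry T)
    (g : H) {f : H} (hf : f ∈ T.kerᗮ) : ⟪T g, T f⟫_ℂ = ⟪g, f⟫_ℂ := by
  let J : T.kerᗮ →ₗᵢ[ℂ] K := ⟨(T : H →ₗ[ℂ] K).comp (Submodule.subtype _), fun x => hT x x.2⟩
  rw [← map_starProjection_ker_orthogonal T g]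
  refine (J.inner_map_map ⟨_, T.kerᗮ.starProjection_apply_mem g⟩ ⟨f, hf⟩).trans ?_
  rw [Submodule.coe_inner, Submodule.inner_starProjection_left_eq_right,
    Submodule.starProjection_eq_self_iff.mpr hf]

/-- If `T` is a partial isometry whose range contains `N`, then compressing `T T*` to the preimage
of `N` gives the projection onto `N`: the preimage contains the kernel of `T`, so its projection
commutes with the initial projection of `T`. -/
theorem IsPartialIsometry.map_starProjection_comap {T : H →L[ℂ] K} (hT : IsPartialIsometry T)
    (N : Submodule ℂ K) [N.HasOrthogonalProjection] (hN : (N : Set K) ⊆ Set.range T)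
    (L : Submodule ℂ H) [L.HasOrthogonalProjection] (hL : ∀ f, f ∈ L ↔ T f ∈ N) (g : K) :
    T (L.starProjection (ContinuousLinearMap.adjoint T g)) = N.starProjection g := by
  refine (Submodule.eq_starProjection_of_mem_of_inner_eq_zero
    ((hL _).mp (Submodule.starProjection_apply_mem _ _)) fun n hn => ?_).symm
  obtain ⟨f₀, rfl⟩ := hN hn
  -- replace the preimage `f₀` of `n` by one in the initial space of `T`
  rw [← map_starProjection_ker_orthogonal T f₀] at hn ⊢
  have hf := T.kerᗮ.starProjection_apply_mem f₀
  rw [inner_sub_left, hT.inner_map_map _ hf, Submodule.inner_starProjection_left_eq_right,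
    Submodule.starProjection_eq_self_iff.mpr ((hL _).mpr hn),
    ContinuousLinearMap.adjoint_inner_left, sub_self]

omit [CompleteSpace H] in
theorem inner_sum_smul_sum_smul {ι : Type*} (S : Finset ι) (c d : ι → ℂ) (v w : ι → H) :
    ⟪∑ i ∈ S, c i • v i, ∑ i ∈ S, d i • w i⟫_ℂ =
      ∑ i ∈ S, ∑ j ∈ S, conj (c i) * d j * ⟪v i, w j⟫_ℂ := by
  rw [sum_inner]
  refine Finset.sum_congr rfl fun i _ => ?_
  rw [inner_sum]
  refine Finset.sum_congr rfl fun j _ => ?_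
  rw [inner_smul_left, inner_smul_right, mul_assoc]

omit [CompleteSpace H] [CompleteSpace K] in
/-- A difference of Gram matrices is positive semi-definite exactly when `h i ↦ h' i` extends to a
linear contraction. -/
theorem posSemidef_gram_sub_gram_iff {ι : Type*} {h : ι → H} {h' : ι → K} :
    (Matrix.gram ℂ h - Matrix.gram ℂ h').PosSemidef ↔
      ∀ c : ι →₀ ℂ, ‖c.sum fun i z => z • h' i‖ ≤ ‖c.sum fun i z => z • h i‖ := by
  have key : ∀ c : ι →₀ ℂ,
      (c.sum fun i xi ↦ c.sum fun j xj ↦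
        star xi * (Matrix.gram ℂ h - Matrix.gram ℂ h') i j * xj) =
      ((‖c.sum fun i z => z • h i‖ ^ 2 - ‖c.sum fun i z => z • h' i‖ ^ 2 : ℝ) : ℂ) := by
    intro c
    have e1 := inner_self_eq_norm_sq_to_K (𝕜 := ℂ) (c.sum fun i z => z • h i)
    have e2 := inner_self_eq_norm_sq_to_K (𝕜 := ℂ) (c.sum fun i z => z • h' i)
    simp only [Complex.coe_algebraMap] at e1 e2
    rw [Complex.ofReal_sub, Complex.ofReal_pow, Complex.ofReal_pow, ← e1, ← e2]
    simp only [Finsupp.sum, inner_sum_smul_sum_smul, Matrix.sub_apply, Matrix.gram_apply,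
      ← Finset.sum_sub_distrib]
    refine Finset.sum_congr rfl fun i _ => Finset.sum_congr rfl fun j _ => ?_
    simp only [RCLike.star_def]
    ring
  rw [Matrix.PosSemidef]
  constructor
  · rintro ⟨-, h2⟩ c
    have := h2 c
    rw [key, Complex.zero_le_real, sub_nonneg] at this
    exact (sq_le_sq₀ (norm_nonneg _) (norm_nonneg _)).mp this
  · intro h2
    refine ⟨(Matrix.isHermitian_gram ℂ h).sub (Matrix.isHermitian_gram ℂ h'), fun c => ?_⟩
    rw [key, Complex.zero_le_real, sub_nonneg]
    exact pow_le_pow_left₀ (norm_nonneg _) (h2 c) 2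

omit [CompleteSpace H] [CompleteSpace K] in
theorem norm_sum_le_of_posSemidef_gram_sub_gram {ι : Type*} {h : ι → H} {h' : ι → K}
    (hh : (Matrix.gram ℂ h - Matrix.gram ℂ h').PosSemidef) (S : Finset ι) :
    ‖∑ i ∈ S, h' i‖ ≤ ‖∑ i ∈ S, h i‖ := by
  classical
  have h0 := posSemidef_gram_sub_gram_iff.mp hh (Finsupp.indicator S fun _ _ => 1)
  rw [Finsupp.sum_of_support_subset _ (Finsupp.support_indicator_subset _ _) _ (by simp),
    Finsupp.sum_of_support_subset _ (Finsupp.support_indicator_subset _ _) _ (by simp)] at h0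
  have e1 : ∀ i ∈ S, (Finsupp.indicator S fun _ _ => (1 : ℂ)) i = 1 :=
    fun i hi => Finsupp.indicator_of_mem hi _
  have e2 : ∀ i ∈ S, (Finsupp.indicator S fun _ _ => (1 : ℂ)) i • h i = h i :=
    fun i hi => by rw [e1 i hi, one_smul]
  have e3 : ∀ i ∈ S, (Finsupp.indicator S fun _ _ => (1 : ℂ)) i • h' i = h' i :=
    fun i hi => by rw [e1 i hi, one_smul]
  rwa [Finset.sum_congr rfl e2, Finset.sum_congr rfl e3] at h0

omit [CompleteSpace H] in
/-- Gram matrices over an arbitrary, possibly infinite, index set are positive semi-definite. -/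
theorem posSemidef_gram {ι : Type*} (h : ι → H) : (Matrix.gram ℂ h).PosSemidef := by
  have h0 : Matrix.gram ℂ h = Matrix.gram ℂ h - Matrix.gram ℂ fun _ : ι => (0 : ℂ) := by
    ext i j
    simp
  rw [h0, posSemidef_gram_sub_gram_iff]
  exact fun c => by simp

end Hilbert

/-! ### Operators into reproducing kernel Hilbert spaces -/

section RKHSLemmas

variable {X V H K : Type*} [NormedAddCommGroup V] [InnerProductSpace ℂ V] [CompleteSpace V]
  [NormedAddCommGroup H] [InnerProductSpace ℂ H] [CompleteSpace H] [RKHS ℂ H X V]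
  [NormedAddCommGroup K] [InnerProductSpace ℂ K] [CompleteSpace K]

/-- Contractivity on finite combinations of kernel functions suffices to define a contraction into
`H`: since the kernel functions span a dense subspace, `kerFun x v ↦ T x v` extends to a contraction
on `H`, and the operator sought is its adjoint. -/
theorem exists_clm_of_kerFun_bound (T : X → V →ₗ[ℂ] K)
    (hT : ∀ f : X →₀ V, ‖f.sum fun x v => T x v‖ ≤ ‖f.sum fun x v => RKHS.kerFun H x v‖) :
    ∃ A : K →L[ℂ] H, ‖A‖ ≤ 1 ∧ (∀ x v, ContinuousLinearMap.adjoint A (RKHS.kerFun H x v) = T x v) ∧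
      ∀ u x v, ⟪v, A u x⟫_ℂ = ⟪T x v, u⟫_ℂ := by
  let e : (X →₀ V) →ₗ[ℂ] H := Finsupp.lsum ℂ fun x => (RKHS.kerFun H x : V →ₗ[ℂ] H)
  let t : (X →₀ V) →ₗ[ℂ] K := Finsupp.lsum ℂ T
  have hb : ∀ f, ‖t f‖ ≤ 1 * ‖e f‖ := fun f => by
    rw [one_mul]; exact hT f
  have hd : DenseRange e := by
    have h := RKHS.kerFun_dense (𝕜 := ℂ) (X := X) (V := V) H
    have hle : Submodule.span ℂ {RKHS.kerFun H x v | (x) (v)} ≤ LinearMap.range e := by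
      rw [Submodule.span_le]
      rintro _ ⟨x, v, rfl⟩
      exact ⟨Finsupp.single x v, by simp [e]⟩
    have h2 := Submodule.topologicalClosure_mono hle
    rw [h, top_le_iff] at h2
    exact (Submodule.dense_iff_topologicalClosure_eq_top (s := LinearMap.range e)).mpr h2
  have hS : ∀ x v, t.extendOfNorm e (RKHS.kerFun H x v) = T x v := fun x v => by
    have := LinearMap.extendOfNorm_eq hd ⟨1, hb⟩ (Finsupp.single x v)
    simpa [e, t] using this
  refine ⟨ContinuousLinearMap.adjoint (t.extendOfNorm e), ?_, fun x v => ?_, fun u x v => ?_⟩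
  · rw [LinearIsometryEquiv.norm_map]
    exact LinearMap.opNorm_extendOfNorm_le hd zero_le_one hb
  · rw [ContinuousLinearMap.adjoint_adjoint, hS]
  · rw [← RKHS.kerFun_inner, ContinuousLinearMap.adjoint_inner_right, hS]

end RKHSLemmas

/-! ### Row multipliers -/

section Rows

variable {X : Type u}

theorem inner_kerFun_kerFun (k : PDKernel X) {E : Type v} [NormedAddCommGroup E]
    [InnerProductSpace ℂ E] [CompleteSpace E] (x y : X) (v w : E) :
    ⟪RKHS.kerFun (k.Space E) x v, RKHS.kerFun (k.Space E) y w⟫_ℂ = k x y * ⟪v, w⟫_ℂ := by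
  rw [RKHS.kerFun_inner, RKHS.kerFun_apply, kernel_space, smul_apply,
    ContinuousLinearMap.id_apply, inner_smul_right]

theorem conj_apply (k : PDKernel X) (x y : X) : conj (k x y) = k y x := by
  simpa using k.posSemidef.isHermitian.apply y x

/-- A kernel that vanishes at a diagonal point vanishes on the whole row of that point. -/
theorem apply_eq_zero_of_diag_eq_zero (k : PDKernel X) {x : X} (hx : k x x = 0) (y : X) :
    k x y = 0 := by
  have h : RKHS.kerFun (k.Space ℂ) x 1 = 0 := by
    rw [← inner_self_eq_zero (𝕜 := ℂ), inner_kerFun_kerFun, hx, zero_mul]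
  have h2 := k.inner_kerFun_kerFun x y (1 : ℂ) (1 : ℂ)
  rw [h, inner_zero_left] at h2
  simpa using h2.symm

theorem exists_re_apply_self (k : PDKernel X) (x : X) : ∃ r : ℝ, 0 ≤ r ∧ k x x = r := by
  have h := k.posSemidef.diag_nonneg (i := x)
  rw [Matrix.of_apply] at h
  exact ⟨(k x x).re, (Complex.nonneg_iff.mp h).1, Complex.ext rfl (Complex.nonneg_iff.mp h).2.symm⟩

/-- A positive semi-definite matrix over a finite set is a Gram matrix in some `ℂ^n`. -/
theorem exists_inner_eq_of_posSemidef {S : Finset X} {G : X → X → ℂ}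
    (hG : (Matrix.of fun x y : S => G x y).PosSemidef) :
    ∃ (n : ℕ) (a : S → EuclideanSpace ℂ (Fin n)), ∀ x y, ⟪a x, a y⟫_ℂ = G x y := by
  obtain ⟨n, v, hv⟩ := Matrix.posSemidef_iff_eq_sum_vecMulVec.mp hG
  refine ⟨n, fun x => WithLp.toLp 2 fun i => conj (v i x), fun x y => ?_⟩
  have h := congrFun (congrFun hv x) y
  rw [Matrix.of_apply, Matrix.sum_apply] at h
  rw [h, PiLp.inner_apply]
  refine Finset.sum_congr rfl fun i _ => ?_
  simp [Matrix.vecMulVec_apply, mul_comm]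

/-- For a complete Nevanlinna-Pick kernel, Pick data consisting of rows over a finite set extend to
all of `X`. Rows are recorded through the Gram matrix `G` of their conjugates, so that the row
multiplier is `v ↦ ⟪a x, v⟫`. -/
theorem IsCompleteNP.exists_row {s : PDKernel X} (hs : s.IsCompleteNP) (S : Finset X)
    (G : X → X → ℂ) (hG : (Matrix.of fun x y : S => G x y).PosSemidef)
    (hsG : (Matrix.of fun x y : S => s x y * (1 - G x y)).PosSemidef) :
    ∃ (n : ℕ) (a : X → EuclideanSpace ℂ (Fin n)), (∀ x ∈ S, ∀ y ∈ S, ⟪a x, a y⟫_ℂ = G x y) ∧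
      (Matrix.of fun x y => s x y * (1 - ⟪a x, a y⟫_ℂ)).PosSemidef := by
  obtain ⟨n, b, hb⟩ := exists_inner_eq_of_posSemidef hG
  let e : EuclideanSpace ℂ (Fin 1) := EuclideanSpace.single 0 1
  have he : ∀ v : EuclideanSpace ℂ (Fin 1), ⟪e, v⟫_ℂ • e = v := fun v => by
    ext i
    rw [Subsingleton.elim i 0]
    simp [e, PiLp.inner_apply]
  have hee : ⟪e, e⟫_ℂ = 1 := by simp [e]
  obtain ⟨Φ, ⟨hΦ, hΦn⟩, hΦS⟩ := hs 1 n S (fun x => (innerSL ℂ (b x)).smulRight e) (by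
    convert! posSemidef_opKernel (⟨_, hsG⟩ : PDKernel S) (EuclideanSpace ℂ (Fin 1)) using 1
    ext1 x y
    have hadj : ∀ v, ContinuousLinearMap.adjoint ((innerSL ℂ (b y)).smulRight e) v =
        ⟪e, v⟫_ℂ • b y := fun v => ext_inner_right ℂ fun w => by
      rw [ContinuousLinearMap.adjoint_inner_left, ContinuousLinearMap.smulRight_apply,
        innerSL_apply_apply, inner_smul_right, inner_smul_left, inner_conj_symm, mul_comm]
    refine ContinuousLinearMap.ext fun v => ?_
    simp only [opKernel, Matrix.of_apply, smul_apply, sub_apply,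
      ContinuousLinearMap.id_apply, ContinuousLinearMap.comp_apply, hadj]
    rw [map_smul, ContinuousLinearMap.smulRight_apply, innerSL_apply_apply, hb, smul_comm, he,
      mul_smul, sub_smul, one_smul])
  let a : X → EuclideanSpace ℂ (Fin n) := fun x => ContinuousLinearMap.adjoint (Φ x) e
  refine ⟨n, a, fun x hx y hy => ?_, ?_⟩
  · have ha : ∀ z : S, a z = b z := fun z => ext_inner_right ℂ fun w => by
      rw [ContinuousLinearMap.adjoint_inner_left, hΦS, ContinuousLinearMap.smulRight_apply,
        innerSL_apply_apply, inner_smul_right, hee, mul_one]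
    rw [ha ⟨x, hx⟩, ha ⟨y, hy⟩, hb]
  · -- the adjoint of the multiplication operator maps `s_x ⊗ e` to `s_x ⊗ a x`
    have hM : ∀ x, ContinuousLinearMap.adjoint (mulOp hΦ) (RKHS.kerFun (s.Space _) x e) =
        RKHS.kerFun (s.Space _) x (a x) := fun x => ext_inner_right ℂ fun w => by
      rw [ContinuousLinearMap.adjoint_inner_left, RKHS.kerFun_inner, RKHS.kerFun_inner,
        mulOp_apply, ContinuousLinearMap.adjoint_inner_left]
    have hnorm : ‖ContinuousLinearMap.adjoint (mulOp hΦ)‖ ≤ 1 := by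
      rwa [LinearIsometryEquiv.norm_map]
    convert! (posSemidef_gram_sub_gram_iff
      (h := fun x => RKHS.kerFun (s.Space (EuclideanSpace ℂ (Fin 1))) x e)
      (h' := fun x => RKHS.kerFun (s.Space (EuclideanSpace ℂ (Fin n))) x (a x))).mpr
      fun c => ?_ using 1
    · ext x y
      rw [Matrix.sub_apply, Matrix.gram_apply, Matrix.gram_apply, inner_kerFun_kerFun,
        inner_kerFun_kerFun, hee, Matrix.of_apply, mul_sub]
    · simp only [← hM, ← map_smul, ← map_finsuppSum]
      exact ContinuousLinearMap.le_of_opNorm_le _ hnorm _ |>.trans_eq (one_mul _)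

/-- If `s(x, y) (1 - ⟪a x, a y⟫)` is a kernel then the row `v ↦ ⟪a x, v⟫` is a contractive
multiplier after tensoring with any Hilbert space `F`. -/
theorem exists_row_clm (s : PDKernel X) {n : ℕ} {a : X → EuclideanSpace ℂ (Fin n)}
    (ha : (Matrix.of fun x y => s x y * (1 - ⟪a x, a y⟫_ℂ)).PosSemidef)
    (F : Type w) [NormedAddCommGroup F] [InnerProductSpace ℂ F] [CompleteSpace F] :
    ∃ A : PiLp 2 (fun _ : Fin n => s.Space F) →L[ℂ] s.Space F, ‖A‖ ≤ 1 ∧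
      ∀ u x, A u x = ∑ i, conj (a x i) • u i x := by
  let T : X → F →ₗ[ℂ] PiLp 2 (fun _ : Fin n => s.Space F) := fun x =>
    { toFun := fun v => WithLp.toLp 2 fun i => a x i • RKHS.kerFun (s.Space F) x v
      map_add' := fun v w => by ext i : 1; simp
      map_smul' := fun c v => by ext i : 1; simp [smul_comm c] }
  obtain ⟨A, hA, -, hA2⟩ := exists_clm_of_kerFun_bound (H := s.Space F) T fun f => by
    refine norm_sum_le_of_posSemidef_gram_sub_gram
      (h := fun x => RKHS.kerFun (s.Space F) x (f x)) (h' := fun x => T x (f x)) ?_ f.support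
    convert! ha.hadamard (posSemidef_gram fun x => f x) using 1
    ext x y
    rw [Matrix.sub_apply, Matrix.gram_apply, Matrix.gram_apply, inner_kerFun_kerFun,
      Matrix.hadamard_apply, Matrix.of_apply, Matrix.gram_apply, PiLp.inner_apply,
      PiLp.inner_apply]
    simp only [T, LinearMap.coe_mk, AddHom.coe_mk, inner_smul_left, inner_smul_right,
      inner_kerFun_kerFun, RCLike.inner_apply, mul_sub, mul_one, sub_mul, Finset.mul_sum,
      Finset.sum_mul]
    congr 1
    refine Finset.sum_congr rfl fun i _ => ?_
    ring
  refine ⟨A, hA, fun u x => ext_inner_left ℂ fun v => ?_⟩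
  rw [hA2, PiLp.inner_apply, inner_sum]
  refine Finset.sum_congr rfl fun i _ => ?_
  simp [T, inner_smul_left, inner_smul_right]

/-- The entries of a contractive row multiplier are multipliers of `H_s`. -/
theorem memMult_row (s : PDKernel X) {n : ℕ} {a : X → EuclideanSpace ℂ (Fin n)}
    (ha : (Matrix.of fun x y => s x y * (1 - ⟪a x, a y⟫_ℂ)).PosSemidef) (i : Fin n) :
    s.MemMult fun x => conj (a x i) := by
  classical
  obtain ⟨A, -, hA⟩ := s.exists_row_clm ha ℂ
  refine fun f => ⟨A (PiLp.single 2 i f), fun x => ?_⟩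
  rw [hA, Finset.sum_eq_single i (fun j _ hj => by simp [hj]) (by simp)]
  simp

end Rows

/-! ### The McCullough-Quiggin theorem -/

section CompleteNP

variable {X : Type u}

theorem posSemidef_of_finset_iff {S : Finset X} {A : X → X → ℂ}
    (hA : ∀ x y, conj (A x y) = A y x) :
    (Matrix.of fun x y : S => A x y).PosSemidef ↔
      ∀ c : X → ℂ, 0 ≤ (∑ x ∈ S, ∑ y ∈ S, conj (c x) * c y * A x y).re := by
  classical
  have hH : (Matrix.of fun x y : S => A x y).IsHermitian := by
    ext x y
    exact hA y x
  have hsum : ∀ c : X → ℂ, star (fun x : S => c x) ⬝ᵥ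
      (Matrix.of fun x y : S => A x y).mulVec (fun x : S => c x) =
        ∑ x ∈ S, ∑ y ∈ S, conj (c x) * c y * A x y := fun c => by
    rw [← Finset.sum_coe_sort]
    refine Finset.sum_congr rfl fun x _ => ?_
    rw [← Finset.sum_coe_sort, Matrix.mulVec, dotProduct, Finset.mul_sum]
    refine Finset.sum_congr rfl fun y _ => ?_
    simp only [Pi.star_apply, RCLike.star_def, Matrix.of_apply]
    ring
  rw [Matrix.posSemidef_iff_dotProduct_mulVec]
  constructor
  · rintro ⟨-, h⟩ c
    rw [← hsum]
    exact (Complex.nonneg_iff.mp (h _)).1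
  · refine fun h => ⟨hH, fun c => ?_⟩
    obtain ⟨d, rfl⟩ : ∃ d : X → ℂ, c = fun x : S => d x :=
      ⟨fun x => if hx : x ∈ S then c ⟨x, hx⟩ else 0, by ext x; simp⟩
    refine Complex.nonneg_iff.mpr ⟨?_, (hH.im_star_dotProduct_mulVec_self _).symm⟩
    rw [hsum]
    exact h d

/-- A closed subspace `L` of `H_s ⊗ F` that is invariant under multipliers is invariant under every
contractive row multiplier. For rows with Gram matrix `G`, applying the adjoint of the compressed
row to the projections of the kernel functions shows that `(1 - G)` times the reproducing kernel of
`L` is positive semi-definite. -/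
theorem IsCompleteNP.re_sum_nonneg {s : PDKernel X} (hs : s.IsCompleteNP)
    {F : Type w} [NormedAddCommGroup F] [InnerProductSpace ℂ F] [CompleteSpace F]
    (L : Submodule ℂ (s.Space F)) [L.HasOrthogonalProjection]
    (hL : ∀ φ, s.MemMult φ → ∀ f ∈ L, ∀ g : s.Space F, (∀ x, g x = φ x • f x) → g ∈ L)
    (S : Finset X) (G : X → X → ℂ) (hG : (Matrix.of fun x y : S => G x y).PosSemidef)
    (hsG : (Matrix.of fun x y : S => s x y * (1 - G x y)).PosSemidef) (f : X → F) :
    0 ≤ (∑ x ∈ S, ∑ y ∈ S, (1 - G x y) * ⟪L.starProjection (RKHS.kerFun (s.Space F) x (f x)),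
      RKHS.kerFun (s.Space F) y (f y)⟫_ℂ).re := by
  classical
  obtain ⟨n, a, haG, ha⟩ := hs.exists_row S G hG hsG
  obtain ⟨A, hA, hAu⟩ := s.exists_row_clm ha F
  set q : X → s.Space F := fun x => L.starProjection (RKHS.kerFun (s.Space F) x (f x)) with hq
  have hqL : ∀ x, q x ∈ L := fun x => L.starProjection_apply_mem _
  have hqi : ∀ g ∈ L, ∀ y, ⟪g, RKHS.kerFun (s.Space F) y (f y)⟫_ℂ = ⟪g, q y⟫_ℂ := fun g hg y => by
    rw [hq, ← Submodule.inner_starProjection_left_eq_right,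
      Submodule.starProjection_eq_self_iff.mpr hg]
  -- the adjoint of the row, compressed to `L`, maps `∑ y ∈ S, q y` to `u`
  let u : PiLp 2 (fun _ : Fin n => s.Space F) := WithLp.toLp 2 fun i => ∑ x ∈ S, a x i • q x
  have huL : ∀ i, u i ∈ L := fun i => Submodule.sum_mem _ fun x _ => L.smul_mem _ (hqL x)
  have hAL : A u ∈ L := by
    have h : A u = ∑ i, A (PiLp.single 2 i (u i)) := RKHS.ext fun x => by
      rw [← map_sum, hAu, hAu]
      refine Finset.sum_congr rfl fun i _ => ?_
      congr 2
      simp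
    rw [h]
    refine Submodule.sum_mem _ fun i _ => hL _ (s.memMult_row ha i) _ (huL i) _ fun x => ?_
    rw [hAu, Finset.sum_eq_single i (fun j _ hj => by simp [hj]) (by simp)]
    simp
  have huu : ⟪u, u⟫_ℂ = ∑ x ∈ S, ∑ y ∈ S, G x y * ⟪q x, q y⟫_ℂ := by
    have h : ∀ i, ⟪u i, u i⟫_ℂ = ∑ x ∈ S, ∑ y ∈ S, conj (a x i) * a y i * ⟪q x, q y⟫_ℂ :=
      fun i => inner_sum_smul_sum_smul S _ _ q q
    rw [PiLp.inner_apply, Finset.sum_congr rfl fun i _ => h i, Finset.sum_comm]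
    refine Finset.sum_congr rfl fun x hx => ?_
    rw [Finset.sum_comm]
    refine Finset.sum_congr rfl fun y hy => ?_
    rw [← Finset.sum_mul, ← haG x hx y hy, PiLp.inner_apply]
    simp [mul_comm]
  have hAuh : ⟪u, u⟫_ℂ = ⟪A u, ∑ y ∈ S, q y⟫_ℂ := by
    have h : ∀ i, ⟪u i, u i⟫_ℂ = ∑ y ∈ S, a y i * ⟪u i y, f y⟫_ℂ := fun i => by
      conv_lhs => rw [show u i = ∑ x ∈ S, a x i • q x from rfl, inner_sum]
      refine Finset.sum_congr rfl fun y _ => ?_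
      rw [inner_smul_right, ← hqi _ (huL i), RKHS.inner_kerFun]
    rw [PiLp.inner_apply, Finset.sum_congr rfl fun i _ => h i, Finset.sum_comm, inner_sum]
    refine Finset.sum_congr rfl fun y _ => ?_
    rw [← hqi _ hAL, RKHS.inner_kerFun, hAu, sum_inner]
    simp [inner_smul_left]
  have hle : ‖u‖ ≤ ‖∑ y ∈ S, q y‖ := by
    have h1 : ‖u‖ ^ 2 ≤ ‖u‖ * ‖∑ y ∈ S, q y‖ := by
      calc ‖u‖ ^ 2 = ‖⟪u, u⟫_ℂ‖ := by simp [inner_self_eq_norm_sq_to_K]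
        _ = ‖⟪A u, ∑ y ∈ S, q y⟫_ℂ‖ := by rw [hAuh]
        _ ≤ ‖A u‖ * ‖∑ y ∈ S, q y‖ := norm_inner_le_norm _ _
        _ ≤ ‖u‖ * ‖∑ y ∈ S, q y‖ := by
          gcongr
          exact (A.le_of_opNorm_le hA u).trans_eq (one_mul _)
    rcases (norm_nonneg u).eq_or_lt with h0 | h0
    · rw [← h0]
      exact norm_nonneg _
    · rw [sq] at h1
      exact le_of_mul_le_mul_left h1 h0
  have hfin : (∑ x ∈ S, ∑ y ∈ S, (1 - G x y) * ⟪q x, RKHS.kerFun (s.Space F) y (f y)⟫_ℂ) =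
      ((‖∑ y ∈ S, q y‖ ^ 2 - ‖u‖ ^ 2 : ℝ) : ℂ) := by
    have e1 := inner_self_eq_norm_sq_to_K (𝕜 := ℂ) u
    have e2 := inner_self_eq_norm_sq_to_K (𝕜 := ℂ) (∑ y ∈ S, q y)
    simp only [Complex.coe_algebraMap] at e1 e2
    rw [Complex.ofReal_sub, Complex.ofReal_pow, Complex.ofReal_pow, ← e1, ← e2, huu, sum_inner,
      ← Finset.sum_sub_distrib]
    refine Finset.sum_congr rfl fun x _ => ?_
    rw [inner_sum, ← Finset.sum_sub_distrib]
    refine Finset.sum_congr rfl fun y _ => ?_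
    rw [hqi _ (hqL x)]
    ring
  rw [hfin, Complex.ofReal_re, sub_nonneg]
  exact pow_le_pow_left₀ (norm_nonneg _) hle 2

theorem IsNormalized.apply_self_ne_zero {s : PDKernel X} (hs : s.IsNormalized) (x : X) :
    s x x ≠ 0 := by
  obtain ⟨x₀, h₀⟩ := hs
  intro h
  exact one_ne_zero ((h₀ x).symm.trans (s.apply_eq_zero_of_diag_eq_zero h x₀))

/-- If `s(x, y) = 0`, interpolating the values `1` at `x` and `-1` at `y` is an admissible Pick
problem. As these values are unimodular, equality in Cauchy-Schwarz forces a solution to take both values at the base point. -/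
theorem IsCompleteNP.apply_ne_zero {s : PDKernel X} (hs : s.IsCompleteNP) (hn : s.IsNormalized)
    (x y : X) : s x y ≠ 0 := by
  classical
  intro hxy
  have hyx : s y x = 0 := by rw [← s.conj_apply, hxy, map_zero]
  have hne : x ≠ y := fun h => hn.apply_self_ne_zero x (by rw [← h] at hxy; exact hxy)
  obtain ⟨x₀, h₀⟩ := hn
  let c : X → ℂ := fun z => if z = x then 1 else -1
  have hcx : c x = 1 := if_pos rfl
  have hcy : c y = -1 := if_neg hne.symm
  obtain ⟨n, a, haG, ha⟩ := hs.exists_row {x, y} (fun z w => ⟪c z, c w⟫_ℂ)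
    ((posSemidef_gram c).submatrix _) (by
      convert! Matrix.PosSemidef.zero using 1
      ext ⟨z, hz⟩ ⟨w, hw⟩
      simp only [Finset.mem_insert, Finset.mem_singleton] at hz hw
      rcases hz with rfl | rfl <;> rcases hw with rfl | rfl <;> simp [hcx, hcy, hxy, hyx])
  let D : PDKernel X := ⟨_, ha⟩
  have hxx : ⟪a x, a x⟫_ℂ = 1 := by rw [haG x (by simp) x (by simp)]; simp [hcx]
  have hyy : ⟪a y, a y⟫_ℂ = 1 := by rw [haG y (by simp) y (by simp)]; simp [hcy]
  have hxy' : ⟪a x, a y⟫_ℂ = -1 := by rw [haG x (by simp) y (by simp)]; simp [hcx, hcy]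
  have hyx' : ⟪a y, a x⟫_ℂ = -1 := by rw [haG y (by simp) x (by simp)]; simp [hcx, hcy]
  have hD : ∀ z, ⟪a z, a z⟫_ℂ = 1 → ⟪a z, a x₀⟫_ℂ = 1 := fun z hz => by
    have h : s z x₀ * (1 - ⟪a z, a x₀⟫_ℂ) = 0 :=
      D.apply_eq_zero_of_diag_eq_zero
        (show s z z * (1 - ⟪a z, a z⟫_ℂ) = 0 by rw [hz, sub_self, mul_zero]) x₀
    rw [h₀, one_mul, sub_eq_zero] at h
    exact h.symm
  have hadd : a x + a y = 0 := by
    rw [← inner_self_eq_zero (𝕜 := ℂ), inner_add_left, inner_add_right, inner_add_right, hxx, hyy,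
      hxy', hyx']
    norm_num
  have h2 : ⟪a x + a y, a x₀⟫_ℂ = 2 := by
    rw [inner_add_left, hD x hxx, hD y hyy]
    norm_num
  rw [hadd, inner_zero_left] at h2
  norm_num at h2

/-- The reproducing kernel of the subspace of functions in `H_s` that vanish at `z`. -/
theorem inner_starProjection_orthogonal_kerFun (s : PDKernel X) (x y z : X) (c d : ℂ) :
    ⟪(ℂ ∙ RKHS.kerFun (s.Space ℂ) z 1)ᗮ.starProjection (RKHS.kerFun (s.Space ℂ) x c),
      RKHS.kerFun (s.Space ℂ) y d⟫_ℂ = conj c * d * (s x y - s x z * s z y / s z z) := by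
  have hz : conj (RCLike.ofReal (‖RKHS.kerFun (s.Space ℂ) z 1‖ ^ 2) : ℂ) = s z z := by
    have h := inner_self_eq_norm_sq_to_K (𝕜 := ℂ) (RKHS.kerFun (s.Space ℂ) z 1)
    rw [inner_kerFun_kerFun] at h
    simpa using h.symm
  rw [Submodule.starProjection_orthogonal_val, Submodule.starProjection_singleton]
  simp only [inner_sub_left, inner_smul_left, inner_kerFun_kerFun, RCLike.inner_apply, map_div₀,
    map_mul, conj_apply, map_one, mul_one]
  rw [hz]
  ring

/-- The McCullough-Quiggin theorem: for a complete Nevanlinna-Pick kernel, one minus the reciprocal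
of the kernel normalized at any point `z` is positive semi-definite on finite sets. The induction
adds a point `a`: positivity for the base point `a` makes one minus the reciprocal of the kernel
normalized at `a` the Gram matrix of admissible Pick data, and the invariant subspace of functions
that vanish at `z` then gives positivity for the base point `z`. -/
theorem IsCompleteNP.posSemidef_one_sub {s : PDKernel X} (hs : s.IsCompleteNP)
    (hn : s.IsNormalized) (S : Finset X) (z : X) :
    (Matrix.of fun x y : S => 1 - s x z * s z y / (s z z * s x y)).PosSemidef := by
  classical
  have hherm : ∀ z x y : X, conj (1 - s x z * s z y / (s z z * s x y)) =
      1 - s y z * s z x / (s z z * s y x) := fun z x y => by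
    simp only [map_sub, map_one, map_div₀, map_mul, conj_apply]
    ring
  have hne := hs.apply_ne_zero hn
  induction S using Finset.induction_on generalizing z with
  | empty => exact (posSemidef_of_finset_iff (hherm z)).mpr fun c => by simp
  | insert a S ha ih =>
    obtain ⟨r, hr0, hr⟩ := s.exists_re_apply_self a
    have hrr : ((√r : ℝ) : ℂ) * (√r : ℝ) = s a a := by
      rw [hr, ← Complex.ofReal_mul, Real.mul_self_sqrt hr0]
    have hsr : ((√r : ℝ) : ℂ) ≠ 0 := fun h => hne a a (by rw [← hrr, h, zero_mul])
    refine (posSemidef_of_finset_iff (hherm z)).mpr fun c => ?_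
    have key := hs.re_sum_nonneg (ℂ ∙ RKHS.kerFun (s.Space ℂ) z 1)ᗮ
      (fun φ _ f hf g hg => by
        rw [Submodule.mem_orthogonal_singleton_iff_inner_right, RKHS.kerFun_inner] at hf ⊢
        simp only [RCLike.inner_apply, map_one, mul_one] at hf ⊢
        rw [hg, hf, smul_zero])
      (insert a S) (fun x y => 1 - s x a * s a y / (s a a * s x y))
      ((posSemidef_of_finset_iff (hherm a)).mpr fun c => by
        -- the row and the column of `a` vanish, so this is positivity on `S`
        have h1 : ∀ y, 1 - s a a * s a y / (s a a * s a y) = 0 := fun y => by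
          rw [div_self (mul_ne_zero (hne a a) (hne a y)), sub_self]
        have h2 : ∀ x, 1 - s x a * s a a / (s a a * s x a) = 0 := fun x => by
          rw [mul_comm, div_self (mul_ne_zero (hne a a) (hne x a)), sub_self]
        simp only [Finset.sum_insert ha, h1, h2, mul_zero, Finset.sum_const_zero, zero_add]
        exact (posSemidef_of_finset_iff (hherm a)).mp (ih a) c)
      (by
        convert! (posSemidef_gram fun y => s a y / (√r : ℝ)).submatrix
          (fun x : (insert a S : Finset X) => (x : X)) using 1
        ext x y
        simp only [Matrix.of_apply, Matrix.submatrix_apply, Matrix.gram_apply, RCLike.inner_apply,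
          map_div₀, conj_apply, Complex.conj_ofReal]
        rw [sub_sub_cancel, ← hrr]
        have := hne x y
        field_simp)
      fun x => c x * (√r : ℝ) / s a x
    -- the weights of the test vector cancel `1 - G x y = s x a * s a y / (s a a * s x y)`
    refine key.trans_eq (congrArg Complex.re ?_)
    refine Finset.sum_congr rfl fun x _ => Finset.sum_congr rfl fun y _ => ?_
    rw [inner_starProjection_orthogonal_kerFun]
    simp only [map_div₀, map_mul, conj_apply, Complex.conj_ofReal]
    rw [sub_sub_cancel, ← hrr]
    have := hne x y
    have := hne x a
    have := hne a y
    have := hne z z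
    field_simp

end CompleteNP

/-! ### Multiplier invariant subspaces -/

section InvariantSubspaces

variable {X : Type u}

/-- For a normalized complete Nevanlinna-Pick kernel `s`, the quotient by `s` of the reproducing
kernel of a multiplier invariant subspace `L` of `H_s ⊗ F` is positive semi-definite. -/
theorem IsCompleteNP.posSemidef_quotient {s : PDKernel X} (hs : s.IsCompleteNP)
    (hn : s.IsNormalized) {F : Type w} [NormedAddCommGroup F] [InnerProductSpace ℂ F]
    [CompleteSpace F] (L : Submodule ℂ (s.Space F)) [L.HasOrthogonalProjection]
    (hL : ∀ φ, s.MemMult φ → ∀ f ∈ L, ∀ g : s.Space F, (∀ x, g x = φ x • f x) → g ∈ L) :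
    (Matrix.of fun x y => (s x y)⁻¹ • ((RKHS.kerFun (s.Space F) x).adjoint ∘L L.starProjection ∘L
      RKHS.kerFun (s.Space F) y) : Matrix X X (F →L[ℂ] F)).PosSemidef := by
  have hne := hs.apply_ne_zero hn
  refine (RKHS.posSemidef_tfae.out 0 2).mpr (And.intro ?_ fun f => ?_)
  · ext x y v
    refine ext_inner_right ℂ fun w => ?_
    rw [Matrix.conjTranspose_apply, ContinuousLinearMap.star_eq_adjoint,
      ContinuousLinearMap.adjoint_inner_left]
    simp only [Matrix.of_apply, smul_apply, ContinuousLinearMap.comp_apply, inner_smul_left,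
      inner_smul_right, map_inv₀, conj_apply]
    rw [ContinuousLinearMap.adjoint_inner_left, ContinuousLinearMap.adjoint_inner_right,
      Submodule.inner_starProjection_left_eq_right]
  · obtain ⟨x₀, h₀⟩ := id hn
    have h₀' : ∀ x, s x₀ x = 1 := fun x => by rw [← conj_apply, h₀, map_one]
    have hG := hs.posSemidef_one_sub hn f.support x₀
    -- the base point `x₀` has `s x x₀ = 1`, so that the Pick matrix `s (1 - G)` is constant
    have key := hs.re_sum_nonneg L hL f.support
      (fun x y => 1 - s x x₀ * s x₀ y / (s x₀ x₀ * s x y)) hG (by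
      convert! (posSemidef_gram fun _ : f.support => (1 : ℂ)) using 1
      ext x y
      have := hne x y
      simp [h₀, h₀', Matrix.gram_apply, this]) f
    refine key.trans_eq (congrArg Complex.re ?_)
    refine Finset.sum_congr rfl fun x _ => Finset.sum_congr rfl fun y _ => ?_
    simp only [Matrix.of_apply, smul_apply, ContinuousLinearMap.comp_apply, inner_smul_left,
      map_inv₀, conj_apply]
    rw [ContinuousLinearMap.adjoint_inner_left, h₀, h₀', h₀]
    simp

/-- The Beurling-Lax-Halmos theorem of McCullough and Trent: over a normalized complete
Nevanlinna-Pick kernel, the projection onto a closed multiplier invariant subspace of `H_s ⊗ F` has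
the form `M_Γ M_Γ*`. -/
theorem IsCompleteNP.exists_mulOp_comp_adjoint_eq {s : PDKernel X} (hs : s.IsCompleteNP)
    (hn : s.IsNormalized) {F : Type w} [NormedAddCommGroup F] [InnerProductSpace ℂ F]
    [CompleteSpace F] (L : Submodule ℂ (s.Space F)) [L.HasOrthogonalProjection]
    (hL : ∀ φ, s.MemMult φ → ∀ f ∈ L, ∀ g : s.Space F, (∀ x, g x = φ x • f x) → g ∈ L) :
    ∃ (G : Type (max u w)) (_ : NormedAddCommGroup G) (_ : InnerProductSpace ℂ G)
      (_ : CompleteSpace G) (Γ : X → G →L[ℂ] F) (hΓ : IsMultiplier s s Γ),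
      ∀ g, mulOp hΓ (ContinuousLinearMap.adjoint (mulOp hΓ) g) = L.starProjection g := by
  have hne := hs.apply_ne_zero hn
  have hK := hs.posSemidef_quotient hn L hL
  set K : Matrix X X (F →L[ℂ] F) := Matrix.of fun x y => (s x y)⁻¹ •
    ((RKHS.kerFun (s.Space F) x).adjoint ∘L L.starProjection ∘L RKHS.kerFun (s.Space F) y)
    with hKdef
  have : Fact K.PosSemidef := ⟨hK⟩
  let G := RKHS.OfKernel K
  let Γ : X → G →L[ℂ] F := fun x => ContinuousLinearMap.adjoint (RKHS.kerFun G x)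
  -- `T x v` has the same inner products as the projection of the kernel function at `x` to `L`
  let T : X → F →ₗ[ℂ] s.Space G := fun x => RKHS.kerFun (s.Space G) x ∘L RKHS.kerFun G x
  have hT : ∀ x y v w, ⟪T x v, T y w⟫_ℂ =
      ⟪L.starProjection (RKHS.kerFun (s.Space F) x v),
        L.starProjection (RKHS.kerFun (s.Space F) y w)⟫_ℂ := fun x y v w => by
    have h1 : ⟪RKHS.kerFun G x v, RKHS.kerFun G y w⟫_ℂ = ⟪v, K x y w⟫_ℂ := by
      rw [RKHS.kerFun_inner, RKHS.kerFun_apply, RKHS.OfKernel.kernel_ofKernel]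
    simp only [T, ContinuousLinearMap.coe_coe, ContinuousLinearMap.comp_apply]
    rw [inner_kerFun_kerFun, h1, hKdef, Matrix.of_apply, smul_apply, inner_smul_right,
      mul_inv_cancel_left₀ (hne x y), ContinuousLinearMap.comp_apply,
      ContinuousLinearMap.adjoint_inner_right, ContinuousLinearMap.comp_apply,
      Submodule.inner_starProjection_left_eq_right]
    rw [Submodule.starProjection_eq_self_iff.mpr (L.starProjection_apply_mem _)]
  obtain ⟨A, -, hA1, hA2⟩ := exists_clm_of_kerFun_bound (H := s.Space F) T fun f => by
    calc ‖∑ x ∈ f.support, T x (f x)‖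
        ≤ ‖∑ x ∈ f.support, L.starProjection (RKHS.kerFun (s.Space F) x (f x))‖ := by
          refine norm_sum_le_of_posSemidef_gram_sub_gram ?_ _
          convert! Matrix.PosSemidef.zero using 1
          ext x y
          rw [Matrix.sub_apply, Matrix.gram_apply, Matrix.gram_apply, hT, sub_self,
            Matrix.zero_apply]
      _ ≤ ‖∑ x ∈ f.support, RKHS.kerFun (s.Space F) x (f x)‖ := by
          rw [← map_sum]
          exact L.norm_starProjection_apply_le _
  have hAΓ : ∀ u x, A u x = Γ x (u x) := fun u x => ext_inner_left ℂ fun v => by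
    rw [hA2]
    simp [T, Γ]
  have hΓ : IsMultiplier s s Γ := fun u => ⟨A u, hAΓ u⟩
  have hAM : mulOp hΓ = A := ContinuousLinearMap.ext fun u => RKHS.ext fun x => by
    rw [mulOp_apply, hAΓ]
  refine ⟨G, inferInstance, inferInstance, inferInstance, Γ, hΓ, fun g => ?_⟩
  rw [hAM]
  have hker : ∀ y w, A (ContinuousLinearMap.adjoint A (RKHS.kerFun (s.Space F) y w)) =
      L.starProjection (RKHS.kerFun (s.Space F) y w) := fun y w =>
    RKHS.ext fun x => ext_inner_left ℂ fun v => by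
      rw [hA1, hA2, hT, Submodule.inner_starProjection_left_eq_right,
        Submodule.starProjection_eq_self_iff.mpr (L.starProjection_apply_mem _),
        RKHS.kerFun_inner]
  refine RKHS.ext fun y => ext_inner_right ℂ fun w => ?_
  rw [← RKHS.inner_kerFun, ← RKHS.inner_kerFun, ← ContinuousLinearMap.adjoint_inner_right,
    ← ContinuousLinearMap.adjoint_adjoint A, ContinuousLinearMap.adjoint_inner_left,
    ContinuousLinearMap.adjoint_adjoint, hker, Submodule.inner_starProjection_left_eq_right]

end InvariantSubspaces

end PDKernel

/-! ### Subspaces of the range of a partially isometric multiplier -/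

theorem theorem1p4 {X : Type u}
    {E : Type v} [NormedAddCommGroup E] [InnerProductSpace ℂ E] [CompleteSpace E]
    {F : Type w} [NormedAddCommGroup F] [InnerProductSpace ℂ F] [CompleteSpace F]
    (k s : PDKernel X) (hs : s.IsNormalized) (hsNP : s.IsCompleteNP) (hks : k.QuotientNonneg s)
    (M N : Submodule ℂ (k.Space E))
    (hMclosed : IsClosed (M : Set (k.Space E))) (hM : M ≠ ⊥)
    (hNclosed : IsClosed (N : Set (k.Space E))) (hN : N ≠ ⊥) (hNM : N ≤ M)
    (Φ : X → F →L[ℂ] E) (hΦ : PDKernel.IsPartiallyIsometricMultiplier s k Φ)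
    (hΦM : (M : Set (k.Space E)) = PDKernel.mulRange s k Φ)
    (hNinv : PDKernel.IsMultInvariant s N) :
    ∃ (G : Type (max u w)) (_ : NormedAddCommGroup G) (_ : InnerProductSpace ℂ G)
      (_ : CompleteSpace G) (Γ : X → G →L[ℂ] F),
      PDKernel.IsPartiallyIsometricMultiplier s s Γ ∧
      PDKernel.IsPartiallyIsometricMultiplier s k (fun x => Φ x ∘L Γ x) ∧
      (N : Set (k.Space E)) = PDKernel.mulRange s k (fun x => Φ x ∘L Γ x) := by
  obtain ⟨hΦm, hΦp⟩ := hΦ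
  -- the preimage of `N` under `M_Φ`
  let L : Submodule ℂ (s.Space F) :=
    N.comap (PDKernel.mulOp hΦm : s.Space F →ₗ[ℂ] k.Space E)
  have hLmem : ∀ f, f ∈ L ↔ PDKernel.mulOp hΦm f ∈ N := fun f => Iff.rfl
  have hLclosed : IsClosed (L : Set (s.Space F)) :=
    hNclosed.preimage (PDKernel.mulOp hΦm).continuous
  have : CompleteSpace L := hLclosed.completeSpace_coe
  have : CompleteSpace N := hNclosed.completeSpace_coe
  have hNr : (N : Set (k.Space E)) ⊆ Set.range (PDKernel.mulOp hΦm) := fun g hg => by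
    have hgM : g ∈ (M : Set (k.Space E)) := hNM hg
    rw [hΦM] at hgM
    obtain ⟨f, hf⟩ := hgM
    exact ⟨f, RKHS.ext fun x => by rw [PDKernel.mulOp_apply, hf]⟩
  have hLinv : ∀ φ, s.MemMult φ → ∀ f ∈ L, ∀ g : s.Space F, (∀ x, g x = φ x • f x) → g ∈ L := by
    intro φ hφ f hf g hg
    obtain ⟨g', hg'N, hg'⟩ := hNinv φ hφ _ ((hLmem f).mp hf)
    rw [hLmem, show PDKernel.mulOp hΦm g = g' from RKHS.ext fun x => by
      rw [PDKernel.mulOp_apply, hg, map_smul, hg', PDKernel.mulOp_apply]]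
    exact hg'N
  obtain ⟨G, _, _, _, Γ, hΓ, hΓL⟩ := hsNP.exists_mulOp_comp_adjoint_eq hs L hLinv
  have hΦΓ : PDKernel.IsMultiplier s k (fun x => Φ x ∘L Γ x) := fun f =>
    ⟨PDKernel.mulOp hΦm (PDKernel.mulOp hΓ f), fun x => by
      rw [PDKernel.mulOp_apply, PDKernel.mulOp_apply, ContinuousLinearMap.comp_apply]⟩
  have hcomp : PDKernel.mulOp hΦΓ = PDKernel.mulOp hΦm ∘L PDKernel.mulOp hΓ :=
    ContinuousLinearMap.ext fun f => RKHS.ext fun x => by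
      rw [ContinuousLinearMap.comp_apply, PDKernel.mulOp_apply, PDKernel.mulOp_apply,
        PDKernel.mulOp_apply, ContinuousLinearMap.comp_apply]
  have hproj : ∀ g, PDKernel.mulOp hΦΓ (ContinuousLinearMap.adjoint (PDKernel.mulOp hΦΓ) g) =
      N.starProjection g := fun g => by
    rw [hcomp, ContinuousLinearMap.adjoint_comp, ContinuousLinearMap.comp_apply,
      ContinuousLinearMap.comp_apply, hΓL]
    exact hΦp.map_starProjection_comap N hNr L hLmem g
  refine ⟨G, inferInstance, inferInstance, inferInstance, Γ,
    ⟨hΓ, PDKernel.isPartialIsometry_of_comp_adjoint_eq _ L hΓL⟩,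
    ⟨hΦΓ, PDKernel.isPartialIsometry_of_comp_adjoint_eq _ N hproj⟩, ?_⟩
  rw [← PDKernel.range_eq_of_comp_adjoint_eq _ N hproj]
  ext g
  constructor
  · rintro ⟨f, rfl⟩
    exact ⟨f, fun x => PDKernel.mulOp_apply hΦΓ f x⟩
  · rintro ⟨f, hf⟩
    exact ⟨f, RKHS.ext fun x => by rw [PDKernel.mulOp_apply, hf]⟩
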